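/- Let $H \neq \{0\}$ be a complex Hilbert space and let $T$ be a bounded linear operator on $H$. Let $\mathrm{reg}(T)$ be the set of all $\lambda \in \mathbb{C}$ for which there are an open neighbourhood $U$ of $\lambda$ and an analytic function $G : U \to L(H)$ with values in the bounded linear operators on $H$ such that, for all $\mu \in U$, $$(\mu I - T)G(\mu)(\mu I - T) = \mu I - T \quad\text{and}\quad G(\mu)(\mu I - T)G(\mu) = G(\mu),$$ and let $\sigma_g(T) = \mathbb{C} \setminus \mathrm{reg}(T)$ be the generalized spectrum of $T$. Suppose that $0 \in \mathrm{reg}(T)$. Then $\sigma_g(T)$ is non-empty and $$\mathrm{dist}(0, \sigma_g(T)) = \sup\Big\{ \frac{1}{r_\sigma(S)} : S \in L(H),\ TST = T \Big\},$$ where $r_\sigma(S)$ is the spectral radius of $S$. The supremum is taken in $[0,\infty]$, with $1/0 = \infty$; since the left-hand side is finite, every $S \in L(H)$ with $TST = T$ has $r_\sigma(S) > 0$. -/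

import Mathlib

open scoped ENNReal

/-- `B` is a generalized inverse of the bounded operator `A`: `ABA = A` and `BAB = B`. -/
def IsGeneralizedInverse {H : Type*} [NormedAddCommGroup H] [InnerProductSpace ℂ H]
    (A B : H →L[ℂ] H) : Prop :=
  A * B * A = A ∧ B * A * B = B

/-- `reg(T)`: the complex numbers `l` having an open neighbourhood `U` and an operator-valued
analytic function `G` on `U` such that `G m` is a generalized inverse of `m I - T` for every
`m` in `U`. -/
def regularDomain {H : Type*} [NormedAddCommGroup H] [InnerProductSpace ℂ H]
    (T : H →L[ℂ] H) : Set ℂ :=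
  {l : ℂ | ∃ U : Set ℂ, IsOpen U ∧ l ∈ U ∧ ∃ G : ℂ → (H →L[ℂ] H), AnalyticOnNhd ℂ G U ∧
    ∀ m ∈ U, IsGeneralizedInverse (m • (1 : H →L[ℂ] H) - T) (G m)}

/-- The generalized spectrum `σ_g(T)`, the complement of `reg(T)` in the complex plane. -/
def generalizedSpectrum {H : Type*} [NormedAddCommGroup H] [InnerProductSpace ℂ H]
    (T : H →L[ℂ] H) : Set ℂ :=
  (regularDomain T)ᶜ

/-! ### Inner inverses and the hyperrange. -/

section Hyperrange

variable {E : Type*} [NormedAddCommGroup E] [NormedSpace ℂ E]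

/-! Let M be the hyperrange of T. Analyticity of the generalized inverse near 0 forces N(T) ⊆ M.
Hence every inner inverse S of T preserves M, and S(1 - zS)⁻¹ is an inner inverse of T - z whenever
|z| < 1/r(S) (`sub_smul_inner`). The disc of radius 1/r(S) therefore lies in reg(T), so the distance
dominates the supremum.

Conversely, let a closed disc of radius r lie in reg(T). The hyperrange of l - T is the same M for
all l in the disc, and T is block triangular for M ⊕ Mᗮ: l - T is right invertible on M, and its
compression to Mᗮ is left invertible. Left invertibility of l - A on the disc gives a uniform lower
bound; Parseval over roots of unity turns it into ‖A^(N+1) x‖ ≥ r^(N+1) ‖x‖ for some N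
(`exists_pow_expanding`). In an equivalent Hilbert norm A/r is then expanding, and orthogonal
projection onto its range yields a left inverse of A with spectral radius at most 1/r. Adjoints
treat the right invertible block, and the two one-sided inverses glue to a triangular inner inverse
of T.

If σ_g(T) were empty, the converse with r > ‖T‖ would give S = T⁻¹ with r(S) ≤ 1/r, pushing the
spectrum of T outside the ball of radius ‖T‖. -/

/-- The hyperrange `⋂ n, R(A ^ n)` of a bounded operator. -/
def hyperrange (A : E →L[ℂ] E) : Submodule ℂ E :=
  ⨅ n : ℕ, LinearMap.range (A ^ n : E →L[ℂ] E).toLinearMap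

theorem mem_hyperrange {A : E →L[ℂ] E} {x : E} :
    x ∈ hyperrange A ↔ ∀ n : ℕ, ∃ y, (A ^ n) y = x := by
  simp only [hyperrange, Submodule.mem_iInf, LinearMap.mem_range]
  rfl

theorem hyperrange_neg (A : E →L[ℂ] E) : hyperrange (-A) = hyperrange A := by
  have key : ∀ B : E →L[ℂ] E, hyperrange B ≤ hyperrange (-B) := by
    intro B x hx
    rw [mem_hyperrange] at hx ⊢
    intro n
    obtain ⟨y, hy⟩ := hx n
    rcases n.even_or_odd with h | h
    · exact ⟨y, by rw [h.neg_pow, hy]⟩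
    · exact ⟨-y, by rw [h.neg_pow]; simpa using hy⟩
  exact le_antisymm (by simpa using key (-A)) (key A)

theorem map_mem_hyperrange {A : E →L[ℂ] E} {x : E} (hx : x ∈ hyperrange A) :
    A x ∈ hyperrange A := by
  rw [mem_hyperrange] at hx ⊢
  intro n
  obtain ⟨y, hy⟩ := hx n
  refine ⟨A y, ?_⟩
  rw [← hy, ← mul_apply_eq_comp, ← mul_apply_eq_comp, ← pow_succ,
    ← pow_succ']

theorem le_hyperrange_of_forall_exists {A : E →L[ℂ] E} {M : Submodule ℂ E}
    (h : ∀ x ∈ M, ∃ y ∈ M, A y = x) : M ≤ hyperrange A := by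
  intro x hx
  rw [mem_hyperrange]
  intro n
  suffices ∃ y ∈ M, (A ^ n) y = x from this.imp fun _ h => h.2
  induction n with
  | zero => exact ⟨x, hx, by simp⟩
  | succ n ih =>
    obtain ⟨y, hy, rfl⟩ := ih
    obtain ⟨z, hz, rfl⟩ := h y hy
    exact ⟨z, hz, by rw [pow_succ, mul_apply_eq_comp]⟩

/-- `B` is an inner inverse of `A`, and `N(A)` is contained in the hyperrange of `A`. -/
structure IsRegularInverse (A B : E →L[ℂ] E) : Prop where
  inner : A * B * A = A
  ker_le : ∀ x, A x = 0 → x ∈ hyperrange A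

namespace IsRegularInverse

variable {A B : E →L[ℂ] E}

theorem apply_apply (h : IsRegularInverse A B) (x : E) : A (B (A x)) = A x :=
  congrArg (fun C : E →L[ℂ] E => C x) h.inner

theorem sub_mem (h : IsRegularInverse A B) (x : E) : x - B (A x) ∈ hyperrange A :=
  h.ker_le _ (by rw [map_sub, h.apply_apply, sub_self])

theorem right_inv (h : IsRegularInverse A B) {x : E} (hx : x ∈ hyperrange A) : A (B x) = x := by
  obtain ⟨y, rfl⟩ := mem_hyperrange.1 hx 1
  rw [pow_one, h.apply_apply]

/-- If x = A^(n+1) y, then Bx differs from A^n y by a vector of N(A), which also lies in R(A^n). -/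
theorem map_mem (h : IsRegularInverse A B) {x : E} (hx : x ∈ hyperrange A) :
    B x ∈ hyperrange A := by
  rw [mem_hyperrange]
  intro n
  obtain ⟨y, rfl⟩ := mem_hyperrange.1 hx (n + 1)
  obtain ⟨z, hz⟩ := mem_hyperrange.1 (h.sub_mem ((A ^ n) y)) n
  refine ⟨y - z, ?_⟩
  rw [map_sub, hz, pow_succ', mul_apply_eq_comp, sub_sub_cancel]

theorem isClosed_hyperrange (h : IsRegularInverse A B) :
    IsClosed (hyperrange A : Set E) := by
  -- Closed conditions replace the ranges: these equations telescope to A^n B^n x = x.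
  have : (hyperrange A : Set E) = ⋂ n : ℕ, {x | A ((B ^ (n + 1)) x) = (B ^ n) x} := by
    ext x
    simp only [SetLike.mem_coe, Set.mem_iInter, Set.mem_ofPred_eq]
    constructor
    · intro hx n
      have : (B ^ n) x ∈ hyperrange A := by
        induction n with
        | zero => simpa using hx
        | succ n ih => rw [pow_succ', mul_apply_eq_comp]; exact h.map_mem ih
      rw [pow_succ', mul_apply_eq_comp, h.right_inv this]
    · intro hx
      rw [mem_hyperrange]
      intro n
      refine ⟨(B ^ n) x, ?_⟩
      induction n with
      | zero => simp
      | succ n ih => rw [pow_succ, mul_apply_eq_comp, hx, ih]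
  rw [this]
  exact isClosed_iInter fun n => isClosed_eq (by fun_prop) (by fun_prop)

end IsRegularInverse

/-! ### Propagation of an inner inverse through the Neumann series. -/

section Resolvent

variable [CompleteSpace E]

/-- The inverse is holomorphic on the whole disc of radius 1/r(S), so its Taylor series at 0, which
is the Neumann series, converges there and not only for |z| ‖S‖ < 1. -/
theorem hasSum_inverse_one_sub_smul {S : E →L[ℂ] E} {z : ℂ}
    (hz : (‖z‖₊ : ℝ≥0∞) < (spectralRadius ℂ S)⁻¹) :
    HasSum (fun n : ℕ => z ^ n • S ^ n) (Ring.inverse (1 - z • S)) := by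
  obtain ⟨t, hzt, ht⟩ := ENNReal.lt_iff_exists_nnreal_btwn.1 hz
  have hzt' : ‖z‖₊ < t := by exact_mod_cast hzt
  have H₁ := (spectrum.differentiableOn_inverse_one_sub_smul ht).hasFPowerSeriesOnBall
    (pos_of_gt hzt')
  have H₂ := (spectrum.hasFPowerSeriesOnBall_inverse_one_sub_smul ℂ S).exchange_radius H₁
  have := H₂.hasSum (y := z) (by rw [Metric.mem_eball, edist_zero_right]; exact hzt)
  simpa using this

theorem inverse_one_sub_smul_mem {S : E →L[ℂ] E} {z : ℂ}
    (hz : (‖z‖₊ : ℝ≥0∞) < (spectralRadius ℂ S)⁻¹) {M : Submodule ℂ E}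
    (hM : IsClosed (M : Set E)) (hSM : ∀ x ∈ M, S x ∈ M) {x : E} (hx : x ∈ M) :
    Ring.inverse (1 - z • S) x ∈ M := by
  have hs : HasSum (fun n : ℕ => (z ^ n • S ^ n) x) (Ring.inverse (1 - z • S) x) :=
    (hasSum_inverse_one_sub_smul hz).mapL (ContinuousLinearMap.apply ℂ E x)
  have hpow : ∀ n : ℕ, (S ^ n) x ∈ M := by
    intro n
    induction n with
    | zero => simpa using hx
    | succ n ih => rw [pow_succ']; exact hSM _ ih
  exact hM.mem_of_tendsto hs (.of_forall fun s => M.sum_mem fun n _ => M.smul_mem _ (hpow n))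

namespace IsRegularInverse

variable {A B : E →L[ℂ] E}

/-- An inner inverse propagates to the disc whose radius is the inverse of its spectral radius. -/
theorem sub_smul_inner (h : IsRegularInverse A B) {z : ℂ}
    (hz : (‖z‖₊ : ℝ≥0∞) < (spectralRadius ℂ B)⁻¹) :
    (A - z • 1) * (B * Ring.inverse (1 - z • B)) * (A - z • 1) = A - z • 1 := by
  have hu := spectrum.isUnit_one_sub_smul_of_lt_inv_radius hz
  set R := Ring.inverse (1 - z • B) with hR
  have hR1 : (1 - z • B) * R = 1 := Ring.mul_inverse_cancel _ hu
  have hR2 : R * (1 - z • B) = 1 := Ring.inverse_mul_cancel _ hu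
  -- The only use of N(A) ⊆ hyperrange: 1 - BA maps into the hyperrange, R preserves it, and 1 - AB
  -- vanishes on it.
  have h0 : (1 - A * B) * R * (1 - B * A) = 0 := by
    ext x
    have hx := inverse_one_sub_smul_mem hz h.isClosed_hyperrange
      (fun y hy => h.map_mem hy) (h.sub_mem x)
    have := h.right_inv hx
    simp only [mul_apply_eq_comp, sub_apply,
      one_apply_eq_self, zero_apply]
    rw [← hR] at this
    rw [this, sub_self]
  have hc : (A - z • 1) * (B * R) = 1 - (1 - A * B) * R := by
    have : A * B * R - z • (B * R) = R - z • (B * R) - (1 - A * B) * R := by noncomm_ring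
    have h2 : R - z • (B * R) = 1 := by rw [← hR1]; simp [sub_mul]
    rw [sub_mul, ← mul_assoc, smul_mul_assoc, one_mul, this, h2]
  have hd : (1 - A * B) * A = 0 := by rw [sub_mul, h.inner, one_mul, sub_self]
  have he : (1 - A * B) * R * (A - z • 1) = 0 := by
    have h3 : R = 1 + z • (R * B) := by
      have : R - z • (R * B) = 1 := by rw [← hR2]; simp [mul_sub]
      rw [← this]; abel
    have h4 : (1 - A * B) * R * A = z • ((1 - A * B) * R * (B * A)) := by
      conv_lhs => rw [h3]
      rw [mul_add, add_mul, mul_one, hd, zero_add, mul_smul_comm, smul_mul_assoc]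
      simp only [mul_assoc]
    have h5 : (1 - A * B) * R * (B * A) - (1 - A * B) * R = 0 := by
      rw [← neg_eq_zero, ← h0, mul_sub, mul_one, neg_sub]
    rw [mul_sub, h4, mul_smul_comm, mul_one, ← smul_sub, h5, smul_zero]
  rw [hc, sub_mul, one_mul, he, sub_zero]

/-- On the hyperrange AB = 1, so (A - z)B(1 - zB)⁻¹ is the identity there: each vector has a
preimage under A - z inside the same subspace. -/
theorem hyperrange_le_sub_smul (h : IsRegularInverse A B) {z : ℂ}
    (hz : (‖z‖₊ : ℝ≥0∞) < (spectralRadius ℂ B)⁻¹) :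
    hyperrange A ≤ hyperrange (A - z • 1) := by
  refine le_hyperrange_of_forall_exists fun x hx => ?_
  have hu := spectrum.isUnit_one_sub_smul_of_lt_inv_radius hz
  have hx' := inverse_one_sub_smul_mem hz h.isClosed_hyperrange (fun y hy => h.map_mem hy) hx
  refine ⟨B (Ring.inverse (1 - z • B) x), h.map_mem hx', ?_⟩
  have h1 : ((1 - z • B) * Ring.inverse (1 - z • B)) x = x := by
    rw [Ring.mul_inverse_cancel _ hu]; rfl
  simpa [h.right_inv hx'] using h1

end IsRegularInverse
end Resolvent
end Hyperrange

/-! ### Consequences of analyticity; constancy of the hyperrange. -/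

section RegularDomain

open Filter Topology

/-- Comparing Taylor coefficients at l gives (l - T)h₀ = x and (l - T)hₖ₊₁ = -hₖ. The induction
realizes this with `dslope`, for which the equation is known only off l. -/
theorem exists_pow_apply_eq_of_analyticAt {E : Type*} [NormedAddCommGroup E] [NormedSpace ℂ E]
    (T : E →L[ℂ] E) (l : ℂ) (n : ℕ) :
    ∀ (h : ℂ → E) (x : E), AnalyticAt ℂ h l →
      (∀ᶠ m in 𝓝[≠] l, (m • (1 : E →L[ℂ] E) - T) (h m) = x) →
      ∃ y, ((l • (1 : E →L[ℂ] E) - T) ^ n) y = x := by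
  induction n with
  | zero => exact fun h x _ _ => ⟨x, by simp⟩
  | succ n ih =>
    intro h x hh hx
    have hval : (l • (1 : E →L[ℂ] E) - T) (h l) = x := by
      have hc : ContinuousAt (fun m : ℂ => (m • (1 : E →L[ℂ] E) - T) (h m)) l :=
        ContinuousAt.clm_apply (by fun_prop) hh.continuousAt
      exact tendsto_nhds_unique (hc.tendsto.mono_left nhdsWithin_le_nhds)
        (tendsto_const_nhds.congr' (hx.mono fun m hm => hm.symm))
    obtain ⟨p, hp⟩ := hh
    have hd : AnalyticAt ℂ (dslope h l) l := ⟨_, hp.has_fpower_series_dslope_fslope⟩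
    obtain ⟨y, hy⟩ := ih (fun m => dslope h l m) (-h l) hd (by
      filter_upwards [hx, self_mem_nhdsWithin] with m hm hne
      have hne' : m - l ≠ 0 := sub_ne_zero.2 hne
      rw [dslope_of_ne _ hne, slope_def_module, map_smul, map_sub, hm]
      have : (m • (1 : E →L[ℂ] E) - T) (h l) = x + (m - l) • h l := by
        rw [← hval]
        simp only [sub_apply, smul_apply, one_apply_eq_self, sub_smul]
        abel
      rw [this, sub_add_cancel_left, smul_neg, smul_smul, inv_mul_cancel₀ hne', one_smul])
    refine ⟨-y, ?_⟩
    rw [pow_succ', mul_apply_eq_comp, map_neg, hy, neg_neg, hval]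

variable {H : Type*} [NormedAddCommGroup H] [InnerProductSpace ℂ H] {T : H →L[ℂ] H}

/-- For x in N(l - T), the function f(m) = x - G(m)(m - T)x takes values in N(m - T) and f(l) = x.
Its divided difference at l is sent by m - T to -x, so the preceding lemma applies. -/
theorem exists_isRegularInverse_of_mem_regularDomain {l : ℂ} (hl : l ∈ regularDomain T) :
    ∃ G : ℂ → (H →L[ℂ] H), ContinuousAt G l ∧
      ∀ᶠ m in 𝓝 l, IsRegularInverse (m • (1 : H →L[ℂ] H) - T) (G m) := by
  obtain ⟨U, hU, hlU, G, hG, hinv⟩ := hl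
  refine ⟨G, (hG l hlU).continuousAt, ?_⟩
  filter_upwards [hU.mem_nhds hlU] with l hl
  refine ⟨(hinv l hl).1, fun x hx => mem_hyperrange.2 fun n => ?_⟩
  set f : ℂ → H := fun m => x - G m ((m • (1 : H →L[ℂ] H) - T) x) with hf
  have hfl : f l = x := by simp only [hf, hx, map_zero, sub_zero]
  have hfa : AnalyticAt ℂ f l := by
    have h1 : AnalyticAt ℂ (fun m : ℂ => m • (1 : H →L[ℂ] H) - T) l := by fun_prop
    have h2 : AnalyticAt ℂ (fun m : ℂ => 1 - G m * (m • (1 : H →L[ℂ] H) - T)) l :=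
      analyticAt_const.sub ((hG l hl).mul h1)
    exact ((ContinuousLinearMap.apply ℂ H x).analyticAt _).fun_comp h2
  obtain ⟨p, hp⟩ := hfa
  have hd : AnalyticAt ℂ (dslope f l) l := ⟨_, hp.has_fpower_series_dslope_fslope⟩
  obtain ⟨y, hy⟩ := exists_pow_apply_eq_of_analyticAt T l n (dslope f l) (-x) hd (by
    filter_upwards [nhdsWithin_le_nhds (hU.mem_nhds hl), self_mem_nhdsWithin] with m hm hne
    have hne' : m - l ≠ 0 := sub_ne_zero.2 hne
    have h0 : (m • (1 : H →L[ℂ] H) - T) (f m) = 0 := by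
      rw [hf, map_sub, sub_eq_zero]
      exact (congrArg (fun C : H →L[ℂ] H => C x) (hinv m hm).1).symm
    rw [dslope_of_ne _ hne, slope_def_module, map_smul, map_sub, h0, hfl]
    have : (m • (1 : H →L[ℂ] H) - T) x = (m - l) • x := by
      have : (m • (1 : H →L[ℂ] H) - T) x = (l • (1 : H →L[ℂ] H) - T) x + (m - l) • x := by
        simp only [sub_apply, smul_apply, one_apply_eq_self, sub_smul]
        abel
      rw [this, hx, zero_add]
    rw [this, zero_sub, smul_neg, smul_smul, inv_mul_cancel₀ hne', one_smul])
  exact ⟨-y, by rw [map_neg, hy, neg_neg]⟩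

theorem exists_isRegularInverse {l : ℂ} (hl : l ∈ regularDomain T) :
    ∃ B, IsRegularInverse (l • (1 : H →L[ℂ] H) - T) B :=
  let ⟨G, _, h⟩ := exists_isRegularInverse_of_mem_regularDomain hl
  ⟨G l, h.self_of_nhds⟩

theorem isRegularInverse_of_zero_mem_regularDomain (hT : (0 : ℂ) ∈ regularDomain T)
    {S : H →L[ℂ] H} (hS : T * S * T = T) : IsRegularInverse T S := by
  obtain ⟨B, hB⟩ := exists_isRegularInverse hT
  refine ⟨hS, fun x hx => ?_⟩
  rw [← hyperrange_neg]
  simpa using hB.ker_le x (by simp [hx])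

theorem isGeneralizedInverse_of_inner {A B : H →L[ℂ] H} (h : A * B * A = A) :
    IsGeneralizedInverse A (B * A * B) :=
  ⟨by rw [show A * (B * A * B) * A = A * B * A * B * A by simp only [mul_assoc], h, h],
    by rw [show B * A * B * A * (B * A * B) = B * (A * B * A * B * A) * B by
      simp only [mul_assoc], h, h, mul_assoc]⟩

variable [CompleteSpace H]

theorem mem_regularDomain_of_lt {S : H →L[ℂ] H} (h : IsRegularInverse T S) {l : ℂ}
    (hl : (‖l‖₊ : ℝ≥0∞) < (spectralRadius ℂ S)⁻¹) : l ∈ regularDomain T := by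
  set F : ℂ → (H →L[ℂ] H) := fun z => -(S * Ring.inverse (1 - z • S)) with hF
  have hFi : ∀ z : ℂ, (‖z‖₊ : ℝ≥0∞) < (spectralRadius ℂ S)⁻¹ →
      (z • (1 : H →L[ℂ] H) - T) * F z * (z • (1 : H →L[ℂ] H) - T) = z • (1 : H →L[ℂ] H) - T := by
    intro z hz
    have := h.sub_smul_inner hz
    rw [← neg_sub T, hF]
    simp only [neg_mul, mul_neg, neg_neg, this]
  refine ⟨{z | (‖z‖₊ : ℝ≥0∞) < (spectralRadius ℂ S)⁻¹},
    isOpen_lt (by fun_prop) continuous_const, hl,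
    fun z => F z * (z • (1 : H →L[ℂ] H) - T) * F z, fun z hz => ?_,
    fun z hz => isGeneralizedInverse_of_inner (hFi z hz)⟩
  · have hFa : AnalyticAt ℂ F z := by
      obtain ⟨u, hu⟩ := spectrum.isUnit_one_sub_smul_of_lt_inv_radius (𝕜 := ℂ) hz
      have h1 : AnalyticAt ℂ (fun z : ℂ => Ring.inverse (1 - z • S)) z := by
        refine AnalyticAt.fun_comp (g := Ring.inverse) ?_ (by fun_prop)
        rw [← hu]
        exact analyticAt_inverse u
      exact (analyticAt_const.mul h1).neg
    have h2 : AnalyticAt ℂ (fun z : ℂ => z • (1 : H →L[ℂ] H) - T) z := by fun_prop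
    exact (hFa.mul h2).mul hFa

theorem hyperrange_eq_of_subset_regularDomain [Nontrivial H] {s : Set ℂ} (hs : IsPreconnected s)
    (hsT : s ⊆ regularDomain T) {l m : ℂ} (hl : l ∈ s) (hm : m ∈ s) :
    hyperrange (l • (1 : H →L[ℂ] H) - T) = hyperrange (m • (1 : H →L[ℂ] H) - T) := by
  refine hs.induction₂ (fun l m => hyperrange (l • (1 : H →L[ℂ] H) - T) =
    hyperrange (m • (1 : H →L[ℂ] H) - T)) (fun l hl => ?_) (fun _ _ _ _ _ _ h1 h2 => h1.trans h2)
    (fun _ _ _ _ h => h.symm) hl hm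
  obtain ⟨G, hG, hinv⟩ := exists_isRegularInverse_of_mem_regularDomain (hsT hl)
  have key : ∀ {a b : ℂ} {B : H →L[ℂ] H}, IsRegularInverse (a • (1 : H →L[ℂ] H) - T) B →
      ‖a - b‖ * ‖B‖ < 1 → hyperrange (a • (1 : H →L[ℂ] H) - T) ≤
        hyperrange (b • (1 : H →L[ℂ] H) - T) := by
    intro a b B hB hab
    have := hB.hyperrange_le_sub_smul (z := a - b) ?_
    · rwa [show a • (1 : H →L[ℂ] H) - T - (a - b) • 1 = b • 1 - T by rw [sub_smul]; abel] at this
    · refine lt_of_lt_of_le ?_ (ENNReal.inv_le_inv.2 (spectrum.spectralRadius_le_nnnorm B))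
      rw [ENNReal.lt_inv_iff_lt_inv, ← one_div, ENNReal.lt_div_iff_mul_lt (by simp) (by simp),
        mul_comm]
      exact_mod_cast hab
  have hl' := hinv.self_of_nhds
  have c1 : ∀ᶠ m in 𝓝 l, ‖l - m‖ * ‖G l‖ < 1 := by
    have : ContinuousAt (fun m => ‖l - m‖ * ‖G l‖) l := by fun_prop
    exact this.eventually_lt_const (by simp)
  -- The reverse inclusion starts from m, so the inverse `G m` varies; continuity of `G` keeps its
  -- norm bounded.
  have c2 : ∀ᶠ m in 𝓝 l, ‖m - l‖ * ‖G m‖ < 1 := by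
    have : ContinuousAt (fun m => ‖m - l‖ * ‖G m‖) l := by fun_prop
    exact this.eventually_lt_const (by simp)
  filter_upwards [nhdsWithin_le_nhds hinv, nhdsWithin_le_nhds c1, nhdsWithin_le_nhds c2]
    with m hm h1 h2
  exact le_antisymm (key hl' h1) (key hm h2)

end RegularDomain

/-! ### From resolvent lower bounds to expanding powers. -/

section Expansion

open Finset Filter Topology

variable {K : Type*} [NormedAddCommGroup K] [InnerProductSpace ℂ K]

/-- Parseval's identity for the discrete Fourier transform of a vector-valued sequence. -/
theorem IsPrimitiveRoot.sum_norm_sq_sum_pow_smul {n : ℕ} (hn : n ≠ 0) {ζ : ℂ}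
    (hζ : IsPrimitiveRoot ζ n) (v : ℕ → K) :
    ∑ j ∈ range n, ‖∑ k ∈ range n, (ζ ^ j) ^ k • v k‖ ^ 2 = n * ∑ k ∈ range n, ‖v k‖ ^ 2 := by
  have hn1 : ‖ζ‖ = 1 := hζ.norm'_eq_one hn
  have hconj : (starRingEnd ℂ) ζ = ζ⁻¹ := (Complex.inv_eq_conj hn1).symm
  have hζ0 : ζ ≠ 0 := hζ.ne_zero hn
  have horth : ∀ k ∈ range n, ∀ l ∈ range n,
      ∑ j ∈ range n, (starRingEnd ℂ) ((ζ ^ j) ^ k) * (ζ ^ j) ^ l = if k = l then (n : ℂ) else 0 := by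
    intro k hk l hl
    have hw : ∀ j, (starRingEnd ℂ) ((ζ ^ j) ^ k) * (ζ ^ j) ^ l = (ζ⁻¹ ^ k * ζ ^ l) ^ j := by
      intro j
      rw [map_pow, map_pow, hconj, mul_pow]
      ring
    simp only [hw]
    split_ifs with hkl
    · subst hkl
      simp [hζ0]
    · have h1 : ζ⁻¹ ^ k * ζ ^ l ≠ 1 := by
        intro h
        rw [inv_pow, inv_mul_eq_one₀ (pow_ne_zero _ hζ0)] at h
        exact hkl (hζ.pow_inj (mem_range.1 hk) (mem_range.1 hl) h)
      have h2 := geom_sum_mul (ζ⁻¹ ^ k * ζ ^ l) n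
      have h3 : (ζ⁻¹ ^ k * ζ ^ l) ^ n = 1 := by
        rw [mul_pow, ← pow_mul, ← pow_mul, mul_comm k, mul_comm l, pow_mul, pow_mul, inv_pow,
          hζ.pow_eq_one]
        simp
      rw [h3, sub_self] at h2
      exact (mul_eq_zero.1 h2).resolve_right (sub_ne_zero.2 h1)
  have hc : ((∑ j ∈ range n, ‖∑ k ∈ range n, (ζ ^ j) ^ k • v k‖ ^ 2 : ℝ) : ℂ) =
      ((n * ∑ k ∈ range n, ‖v k‖ ^ 2 : ℝ) : ℂ) := by
    push_cast
    calc _ = ∑ j ∈ range n, ∑ k ∈ range n, ∑ l ∈ range n,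
          ((starRingEnd ℂ) ((ζ ^ j) ^ k) * (ζ ^ j) ^ l) * inner ℂ (v k) (v l) := by
          refine sum_congr rfl fun j _ => ?_
          rw [← Complex.coe_algebraMap, ← inner_self_eq_norm_sq_to_K, sum_inner]
          refine sum_congr rfl fun k _ => ?_
          rw [inner_sum]
          refine sum_congr rfl fun l _ => ?_
          rw [inner_smul_left, inner_smul_right]
          ring
      _ = ∑ k ∈ range n, ∑ l ∈ range n, ∑ j ∈ range n,
          ((starRingEnd ℂ) ((ζ ^ j) ^ k) * (ζ ^ j) ^ l) * inner ℂ (v k) (v l) := by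
          rw [sum_comm]
          exact sum_congr rfl fun k _ => sum_comm
      _ = ∑ k ∈ range n, ∑ l ∈ range n, (if k = l then (n : ℂ) else 0) * inner ℂ (v k) (v l) := by
          refine sum_congr rfl fun k hk => sum_congr rfl fun l hl => ?_
          rw [← sum_mul, horth k hk l hl]
      _ = _ := by
          rw [mul_sum]
          refine sum_congr rfl fun k hk => ?_
          simp only [ite_mul, zero_mul, sum_ite_eq, hk, if_true]
          rw [inner_self_eq_norm_sq_to_K]
          rfl
  exact_mod_cast hc

/-- At each l = ζ^j s, with ζ a primitive n-th root of unity, l - A sends Σ l^k A^(n-1-k) x to the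
same vector (s^n - A^n)x. Summing the lower bounds over j, Parseval removes the cross terms. -/
theorem sum_norm_pow_sq_le {A : K →L[ℂ] K} {c s : ℝ} (hs : 0 ≤ s) (hc : 0 ≤ c)
    (h : ∀ l : ℂ, ‖l‖ = s → ∀ x, c * ‖x‖ ≤ ‖(l • (1 : K →L[ℂ] K) - A) x‖) {n : ℕ} (hn : n ≠ 0)
    (x : K) :
    c ^ 2 * ∑ k ∈ range n, (s ^ k * ‖(A ^ (n - 1 - k)) x‖) ^ 2 ≤
      2 * (‖(A ^ n) x‖ ^ 2 + (s ^ n * ‖x‖) ^ 2) := by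
  obtain ⟨ζ, hζ⟩ : ∃ ζ : ℂ, IsPrimitiveRoot ζ n := ⟨_, Complex.isPrimitiveRoot_exp n hn⟩
  have hn1 : ‖ζ‖ = 1 := hζ.norm'_eq_one hn
  have hP := hζ.sum_norm_sq_sum_pow_smul hn fun k => ((s : ℂ) ^ k • (A ^ (n - 1 - k)) x)
  have hv : ∀ k, ‖(s : ℂ) ^ k • (A ^ (n - 1 - k)) x‖ = s ^ k * ‖(A ^ (n - 1 - k)) x‖ := by
    intro k
    rw [norm_smul, norm_pow, Complex.norm_real, Real.norm_of_nonneg hs]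
  simp only [hv] at hP
  have hj : ∀ j ∈ range n, c ^ 2 * ‖∑ k ∈ range n, (ζ ^ j) ^ k • (s : ℂ) ^ k •
      (A ^ (n - 1 - k)) x‖ ^ 2 ≤ 2 * (‖(A ^ n) x‖ ^ 2 + (s ^ n * ‖x‖) ^ 2) := by
    intro j _
    set l : ℂ := ζ ^ j * s with hl
    have hls : ‖l‖ = s := by
      rw [hl, norm_mul, norm_pow, hn1, one_pow, one_mul, Complex.norm_real, Real.norm_of_nonneg hs]
    have hln : l ^ n = (s : ℂ) ^ n := by
      rw [hl, mul_pow, ← pow_mul, mul_comm j, pow_mul, hζ.pow_eq_one, one_pow, one_mul]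
    have hcomm : Commute (l • (1 : K →L[ℂ] K)) A := (Commute.one_left A).smul_left l
    have hg := congrArg (fun C : K →L[ℂ] K => C x) (hcomm.mul_geom_sum₂ n)
    have hsum : (∑ k ∈ range n, (l • (1 : K →L[ℂ] K)) ^ k * A ^ (n - 1 - k)) x =
        ∑ k ∈ range n, (ζ ^ j) ^ k • (s : ℂ) ^ k • (A ^ (n - 1 - k)) x := by
      rw [_root_.sum_apply]
      refine sum_congr rfl fun k _ => ?_
      rw [smul_pow, one_pow, smul_mul_assoc, one_mul, smul_smul, ← mul_pow]
      rfl
    rw [mul_apply_eq_comp, hsum, smul_pow, one_pow, hln] at hg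
    have h1 := h l hls (∑ k ∈ range n, (ζ ^ j) ^ k • (s : ℂ) ^ k • (A ^ (n - 1 - k)) x)
    rw [hg] at h1
    have h2 : ‖((s : ℂ) ^ n • (1 : K →L[ℂ] K) - A ^ n) x‖ ≤ s ^ n * ‖x‖ + ‖(A ^ n) x‖ := by
      have := norm_sub_le ((s : ℂ) ^ n • x) ((A ^ n) x)
      rwa [norm_smul, norm_pow, Complex.norm_real, Real.norm_of_nonneg hs] at this
    rw [← mul_pow]
    refine (pow_le_pow_left₀ (by positivity) (h1.trans h2) 2).trans ?_
    nlinarith [sq_nonneg (s ^ n * ‖x‖ - ‖(A ^ n) x‖)]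
  have := sum_le_sum hj
  rw [← mul_sum, hP, sum_const, card_range, nsmul_eq_mul] at this
  have hn0 : (0 : ℝ) < n := by positivity
  refine le_of_mul_le_mul_left ?_ hn0
  linarith

/-- A sequence that dominates a multiple of its partial sums up to its first term, and that stays
above a multiple of its first term, grows exponentially. -/
theorem exists_geometric_lower_bound {δ C : ℝ} (hδ : 0 < δ) (hC : 0 < C) :
    ∃ C' : ℝ, 0 < C' ∧ ∀ b : ℕ → ℝ, 0 ≤ b 0 → (∀ n, C * b 0 ≤ b n) →
      (∀ n, n ≠ 0 → δ * ∑ k ∈ range n, b k ≤ b n + b 0) →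
      ∀ n, C' * (1 + δ / 2) ^ n * b 0 ≤ b n := by
  -- N terms of size at least C b₀ make δ times the partial sum exceed 2b₀, so the extra b₀ costs
  -- only half of δ. N depends on δ and C alone, so `C'` serves all sequences.
  obtain ⟨N, hN⟩ := exists_nat_gt (2 / (δ * C))
  have hN0 : (0 : ℝ) < N := lt_trans (by positivity) hN
  have hN1 : N ≠ 0 := by rintro rfl; simp at hN0
  rw [div_lt_iff₀ (by positivity)] at hN
  set q : ℝ := 1 + δ / 2 with hq
  have hq1 : 1 < q := by rw [hq]; linarith
  have hq0 : 0 < q := by linarith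
  refine ⟨min C 1 * (q ^ N)⁻¹, by positivity, fun b hb0 hbC hb n => ?_⟩
  have hsumN : N * (C * b 0) ≤ ∑ k ∈ range N, b k := by
    calc _ = ∑ k ∈ range N, C * b 0 := by simp
      _ ≤ _ := sum_le_sum fun k _ => hbC k
  have hb_nonneg : ∀ k, 0 ≤ b k := fun k => (mul_nonneg hC.le hb0).trans (hbC k)
  have hbig : ∀ m, 2 * b 0 ≤ δ * ∑ k ∈ range (N + m), b k := by
    intro m
    have h1 : ∑ k ∈ range N, b k ≤ ∑ k ∈ range (N + m), b k :=
      sum_le_sum_of_subset_of_nonneg (range_subset_range.2 (by omega)) fun k _ _ => hb_nonneg k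
    nlinarith [mul_le_mul_of_nonneg_left (hsumN.trans h1) hδ.le]
  have hhalf : ∀ m, δ / 2 * ∑ k ∈ range (N + m), b k ≤ b (N + m) := by
    intro m
    have := hb (N + m) (by omega)
    linarith [hbig m]
  have hgrow : ∀ m, q ^ m * ∑ k ∈ range N, b k ≤ ∑ k ∈ range (N + m), b k := by
    intro m
    induction m with
    | zero => simp
    | succ m ih =>
      rw [← add_assoc, sum_range_succ, pow_succ']
      have := mul_le_mul_of_nonneg_left ih hq0.le
      have h2 := hhalf m
      rw [hq] at *
      linarith
  rcases le_or_gt N n with hn | hn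
  · obtain ⟨m, rfl⟩ := Nat.exists_eq_add_of_le hn
    have h1 : q ^ m * b 0 ≤ b (N + m) := by
      refine le_trans ?_ (hhalf m)
      have h2 := mul_le_mul_of_nonneg_left (hgrow m) (show 0 ≤ δ / 2 by positivity)
      have h3 := mul_le_mul_of_nonneg_left (hbig 0) (show 0 ≤ q ^ m by positivity)
      simp only [add_zero] at h3
      linarith
    refine le_trans ?_ h1
    refine mul_le_mul_of_nonneg_right ?_ hb0
    rw [pow_add, ← mul_assoc, mul_assoc (min C 1), inv_mul_cancel₀ (by positivity), mul_one]
    exact mul_le_of_le_one_left (by positivity) (min_le_right _ _)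
  · refine le_trans ?_ (hbC n)
    refine mul_le_mul_of_nonneg_right ?_ hb0
    rw [mul_assoc]
    refine (mul_le_of_le_one_right (by positivity) ?_).trans (min_le_left _ _)
    rw [inv_mul_le_one₀ (by positivity)]
    exact pow_le_pow_right₀ hq1.le hn.le

/-- A uniform lower bound for `l - A` on a disc forces the powers of `A` to expand faster than the
radius of the disc. -/
theorem exists_pow_expanding {A : K →L[ℂ] K} {c r : ℝ} (hr : 0 < r) (hc : 0 < c)
    (h : ∀ l : ℂ, ‖l‖ ≤ r → ∀ x, c * ‖x‖ ≤ ‖(l • (1 : K →L[ℂ] K) - A) x‖) :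
    ∃ N : ℕ, ∀ x, r ^ (N + 1) * ‖x‖ ≤ ‖(A ^ (N + 1)) x‖ := by
  set δ : ℝ := c ^ 2 / (2 * r ^ 2) with hδ
  have hδ0 : 0 < δ := by positivity
  -- Here t is the square of an expansion rate. While t ≤ r² it can be improved by the fixed factor
  -- 1 + δ/2, so finitely many steps from c² exceed r²; a large power then absorbs C.
  let P : ℝ → Prop := fun t => ∃ C : ℝ, 0 < C ∧ ∀ n x, C * t ^ n * ‖x‖ ^ 2 ≤ ‖(A ^ n) x‖ ^ 2
  have hstart : P (c ^ 2) := by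
    refine ⟨1, one_pos, fun n x => ?_⟩
    rw [one_mul, ← pow_mul, mul_comm 2, pow_mul, ← mul_pow]
    refine pow_le_pow_left₀ (by positivity) ?_ 2
    induction n with
    | zero => simp
    | succ n ih =>
      have := h 0 (by simpa using hr.le) ((A ^ n) x)
      rw [zero_smul, zero_sub, neg_apply, norm_neg] at this
      rw [pow_succ', mul_assoc, pow_succ', mul_apply_eq_comp]
      exact (mul_le_mul_of_nonneg_left ih hc.le).trans this
  have hstep : ∀ t, 0 < t → t ≤ r ^ 2 → P t → P ((1 + δ / 2) * t) := by
    rintro t ht htr ⟨C, hC, hP⟩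
    set s := √t with hs
    have hs0 : 0 < s := Real.sqrt_pos.2 ht
    have hst : s ^ 2 = t := Real.sq_sqrt ht.le
    have hsr : s ≤ r := by rw [hs]; exact Real.sqrt_le_left hr.le |>.2 htr
    obtain ⟨C', hC', hb⟩ := exists_geometric_lower_bound hδ0 hC
    refine ⟨C', hC', fun n x => ?_⟩
    have := hb (fun k => ‖(A ^ k) x‖ ^ 2 / t ^ k) (by positivity) (fun n => ?_) (fun n hn => ?_) n
    · simp only [pow_zero, one_apply_eq_self, div_one] at this
      rw [le_div_iff₀ (by positivity)] at this
      rw [mul_pow]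
      linarith
    · simp only [pow_zero, one_apply_eq_self, div_one]
      rw [le_div_iff₀ (by positivity)]
      linarith [hP n x]
    · simp only [pow_zero, one_apply_eq_self, div_one]
      have h1 := sum_norm_pow_sq_le hs0.le hc.le
        (fun l hl => h l (hl.trans_le hsr)) hn x
      have h2 : ∑ k ∈ range n, (s ^ k * ‖(A ^ (n - 1 - k)) x‖) ^ 2 =
          t ^ (n - 1) * ∑ k ∈ range n, ‖(A ^ k) x‖ ^ 2 / t ^ k := by
        rw [← sum_range_reflect (fun k => ‖(A ^ k) x‖ ^ 2 / t ^ k), mul_sum]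
        refine sum_congr rfl fun k hk => ?_
        have : t ^ (n - 1) = t ^ k * t ^ (n - 1 - k) := by
          rw [← pow_add]; congr 1; have := mem_range.1 hk; omega
        rw [this, mul_pow, ← pow_mul, mul_comm k, pow_mul, hst]
        field_simp
      have h3 : t ^ n = t * t ^ (n - 1) := by rw [← pow_succ']; congr 1; omega
      have h4 : (s ^ n * ‖x‖) ^ 2 = t ^ n * ‖x‖ ^ 2 := by
        rw [mul_pow, ← pow_mul, mul_comm n, pow_mul, hst]
      rw [h2, h4] at h1
      set D := ∑ k ∈ range n, ‖(A ^ k) x‖ ^ 2 / t ^ k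
      have hD : 0 ≤ D := sum_nonneg fun k _ => by positivity
      have h5 : δ * t * D ≤ c ^ 2 / 2 * D := by
        refine mul_le_mul_of_nonneg_right ?_ hD
        rw [hδ, div_mul_eq_mul_div, div_le_div_iff₀ (by positivity) (by positivity)]
        nlinarith [sq_nonneg c]
      rw [div_add' _ _ _ (by positivity), le_div_iff₀ (by positivity)]
      have h6 := mul_le_mul_of_nonneg_right h5 (show 0 ≤ t ^ (n - 1) by positivity)
      rw [h3] at h1 ⊢
      nlinarith
  obtain ⟨t, htr, C, hC, hP⟩ : ∃ t, r ^ 2 < t ∧ P t := by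
    by_contra! hcon
    have hall : ∀ j : ℕ, P ((1 + δ / 2) ^ j * c ^ 2) := by
      intro j
      induction j with
      | zero => simpa using hstart
      | succ j ih =>
        have hle : (1 + δ / 2) ^ j * c ^ 2 ≤ r ^ 2 := by
          by_contra! hlt
          exact hcon _ hlt ih
        rw [pow_succ', mul_assoc]
        exact hstep _ (by positivity) hle ih
    obtain ⟨j, hj⟩ := pow_unbounded_of_one_lt (r ^ 2 / c ^ 2) (show 1 < 1 + δ / 2 by linarith)
    rw [div_lt_iff₀ (by positivity)] at hj
    exact hcon _ hj (hall j)
  obtain ⟨N, hN⟩ := pow_unbounded_of_one_lt (1 / C)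
    (show 1 < t / r ^ 2 from (one_lt_div (by positivity)).2 htr)
  refine ⟨N, fun x => ?_⟩
  have hN1 : 1 / C < (t / r ^ 2) ^ (N + 1) :=
    hN.trans (pow_lt_pow_right₀ ((one_lt_div (by positivity)).2 htr) (Nat.lt_succ_self N))
  rw [div_pow, div_lt_div_iff₀ hC (by positivity), one_mul] at hN1
  refine le_of_sq_le_sq ?_ (norm_nonneg _)
  refine le_trans ?_ (hP (N + 1) x)
  rw [mul_pow, ← pow_mul, mul_comm (N + 1) 2, pow_mul]
  refine mul_le_mul_of_nonneg_right ?_ (by positivity)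
  linarith

/-- Left invertibility of `l - A` at every point of a compact set gives a uniform lower bound. -/
theorem exists_uniform_lower_bound {A : K →L[ℂ] K} {s : Set ℂ} (hs : IsCompact s)
    (h : ∀ l ∈ s, ∃ B : K →L[ℂ] K, B * (l • 1 - A) = 1) :
    ∃ c : ℝ, 0 < c ∧ ∀ l ∈ s, ∀ x, c * ‖x‖ ≤ ‖(l • (1 : K →L[ℂ] K) - A) x‖ := by
  refine hs.induction_on (p := fun s => ∃ c : ℝ, 0 < c ∧ ∀ l ∈ s, ∀ x,
    c * ‖x‖ ≤ ‖(l • (1 : K →L[ℂ] K) - A) x‖) ⟨1, one_pos, by simp⟩ ?_ ?_ ?_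
  · rintro s t hst ⟨c, hc, h⟩
    exact ⟨c, hc, fun l hl => h l (hst hl)⟩
  · rintro s t ⟨c, hc, h⟩ ⟨d, hd, h'⟩
    refine ⟨min c d, lt_min hc hd, fun l hl x => ?_⟩
    rcases hl with hl | hl
    · exact (mul_le_mul_of_nonneg_right (min_le_left _ _) (norm_nonneg x)).trans (h l hl x)
    · exact (mul_le_mul_of_nonneg_right (min_le_right _ _) (norm_nonneg x)).trans (h' l hl x)
  · intro l hl
    obtain ⟨B, hB⟩ := h l hl
    set d : ℝ := (‖B‖ + 1)⁻¹ with hd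
    have hd0 : 0 < d := by positivity
    have hlow : ∀ x, d * ‖x‖ ≤ ‖(l • (1 : K →L[ℂ] K) - A) x‖ := by
      intro x
      have h1 : ‖x‖ ≤ ‖B‖ * ‖(l • (1 : K →L[ℂ] K) - A) x‖ := by
        have : B ((l • (1 : K →L[ℂ] K) - A) x) = x :=
          congrArg (fun C : K →L[ℂ] K => C x) hB
        conv_lhs => rw [← this]
        exact B.le_opNorm _
      rw [hd, inv_mul_le_iff₀ (by positivity)]
      nlinarith [norm_nonneg ((l • (1 : K →L[ℂ] K) - A) x)]
    refine ⟨Metric.ball l (d / 2), mem_nhdsWithin_of_mem_nhds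
      (Metric.ball_mem_nhds l (by positivity)), d / 2, by positivity, fun m hm x => ?_⟩
    have h2 : (l • (1 : K →L[ℂ] K) - A) x = (m • (1 : K →L[ℂ] K) - A) x - (m - l) • x := by
      simp only [sub_apply, smul_apply, one_apply_eq_self, sub_smul]
      abel
    have h3 := hlow x
    rw [h2] at h3
    have h4 := h3.trans (norm_sub_le _ _)
    rw [norm_smul] at h4
    have h5 : ‖m - l‖ ≤ d / 2 := by rw [← dist_eq_norm]; exact (Metric.mem_ball.1 hm).le
    nlinarith [mul_le_mul_of_nonneg_right h5 (norm_nonneg x)]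

end Expansion

/-! ### One-sided inverses with small spectral radius. -/

section LeftInverse

open Finset

variable {K : Type*} [NormedAddCommGroup K] [InnerProductSpace ℂ K] [CompleteSpace K]

theorem spectralRadius_le_of_norm_pow_le {S : K →L[ℂ] K} {C c : ℝ} (hc : 0 ≤ c)
    (h : ∀ n : ℕ, ‖S ^ n‖ ≤ C * c ^ n) : spectralRadius ℂ S ≤ ENNReal.ofReal c := by
  refine iSup₂_le fun k hk => ?_
  rw [← enorm_eq_nnnorm, ← ofReal_norm, ENNReal.ofReal_le_ofReal_iff hc]
  by_contra! hlt
  have hk0 : 0 < ‖k‖ := hc.trans_lt hlt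
  have hn : ∀ n : ℕ, 1 ≤ C * ‖(1 : K →L[ℂ] K)‖ * (c / ‖k‖) ^ n := by
    intro n
    have h1 := spectrum.norm_le_norm_mul_of_mem (spectrum.pow_mem_pow S n hk)
    rw [norm_pow] at h1
    have h2 := h1.trans (mul_le_mul_of_nonneg_right (h n) (norm_nonneg _))
    rw [div_pow, ← mul_div_assoc, le_div_iff₀ (by positivity)]
    linarith
  have ht := (tendsto_pow_atTop_nhds_zero_of_lt_one (by positivity)
    ((div_lt_one hk0).2 hlt)).const_mul (C * ‖(1 : K →L[ℂ] K)‖)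
  have := ge_of_tendsto' ht hn
  norm_num at this

/-- If some power of `A` is expanding, then `A` has a left inverse which is a contraction for an
equivalent Hilbert norm. -/
theorem exists_power_bounded_left_inverse {A : K →L[ℂ] K} {N : ℕ}
    (hA : ∀ x, ‖x‖ ≤ ‖(A ^ (N + 1)) x‖) :
    ∃ (S : K →L[ℂ] K) (C : ℝ), S * A = 1 ∧ ∀ n : ℕ, ‖S ^ n‖ ≤ C := by
  -- Gram operator of the new norm q. The sum stops at k = N, so q(Ax) - q(x) telescopes to ‖A^(N+1)
  -- x‖² - ‖x‖² ≥ 0.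
  set Q : K →L[ℂ] K := ∑ k ∈ range (N + 1), star (A ^ k) * A ^ k with hQ
  have hQi : ∀ x y, inner ℂ (Q x) y = ∑ k ∈ range (N + 1), inner ℂ ((A ^ k) x) ((A ^ k) y) := by
    intro x y
    rw [hQ, _root_.sum_apply, sum_inner]
    refine sum_congr rfl fun k _ => ?_
    rw [mul_apply_eq_comp, ContinuousLinearMap.star_eq_adjoint,
      ContinuousLinearMap.adjoint_inner_left]
  set q : K → ℝ := fun x => ∑ k ∈ range (N + 1), ‖(A ^ k) x‖ ^ 2 with hq
  have hqQ : ∀ x, inner ℂ (Q x) x = (q x : ℂ) := by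
    intro x
    rw [hQi, hq]
    push_cast
    exact sum_congr rfl fun k _ => inner_self_eq_norm_sq_to_K _
  have hq_ge : ∀ x, ‖x‖ ^ 2 ≤ q x := by
    intro x
    have := single_le_sum (f := fun k => ‖(A ^ k) x‖ ^ 2) (fun k _ => by positivity)
      (mem_range.2 (Nat.succ_pos N))
    exact this
  have hq_le : ∀ x, q x ≤ (∑ k ∈ range (N + 1), ‖A ^ k‖ ^ 2) * ‖x‖ ^ 2 := by
    intro x
    rw [hq, sum_mul]
    refine sum_le_sum fun k _ => ?_
    rw [← mul_pow]
    exact pow_le_pow_left₀ (norm_nonneg _) ((A ^ k).le_opNorm x) 2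
  have hqA : ∀ x, q x ≤ q (A x) := by
    intro x
    have h1 : q (A x) = ∑ k ∈ range (N + 1), ‖(A ^ (k + 1)) x‖ ^ 2 :=
      sum_congr rfl fun k _ => by rw [pow_succ A, mul_apply_eq_comp]
    rw [h1, sum_range_succ, hq]
    simp only
    rw [sum_range_succ']
    have := pow_le_pow_left₀ (norm_nonneg x) (hA x) 2
    simpa using this
  have hQsymm : ∀ x y, inner ℂ (Q x) y = inner ℂ x (Q y) := by
    intro x y
    rw [← inner_conj_symm x, hQi, hQi, map_sum]
    exact sum_congr rfl fun k _ => (inner_conj_symm _ _).symm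
  set B : K →L[ℂ] K := star A * Q * A with hB
  have hBi : ∀ x y, inner ℂ (B x) y = inner ℂ (Q (A x)) (A y) := by
    intro x y
    rw [hB, mul_apply_eq_comp, mul_apply_eq_comp, ContinuousLinearMap.star_eq_adjoint,
      ContinuousLinearMap.adjoint_inner_left]
  have hBu : IsUnit B := by
    refine ContinuousLinearMap.isUnit_of_forall_le_norm_inner_map B (c := 1) one_pos fun x => ?_
    rw [hBi, hqQ, Complex.norm_real, NNReal.coe_one, mul_one]
    exact ((hq_ge x).trans (hqA x)).trans (le_abs_self _)
  -- Least squares for q: AS is the q-orthogonal projection onto R(A), whence q(Sx) ≤ q(ASx) ≤ q(x).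
  set S : K →L[ℂ] K := Ring.inverse B * (star A * Q) with hS
  have hSA : S * A = 1 := by
    rw [hS, mul_assoc, ← hB, Ring.inverse_mul_cancel _ hBu]
  have hBS : B * S = star A * Q := by
    rw [hS, ← mul_assoc, Ring.mul_inverse_cancel _ hBu, one_mul]
  have hqS : ∀ x, q (S x) ≤ q x := by
    intro x
    refine (hqA _).trans ?_
    set y := A (S x) with hy
    have horth : inner ℂ (Q (x - y)) y = 0 := by
      have h1 : inner ℂ (Q y) y = inner ℂ (Q x) y := by
        rw [hy, ← hBi, ← mul_apply_eq_comp, hBS, mul_apply_eq_comp,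
          ContinuousLinearMap.star_eq_adjoint, ContinuousLinearMap.adjoint_inner_left]
      rw [map_sub, inner_sub_left, h1, sub_self]
    have horth' : inner ℂ (Q y) (x - y) = 0 := by
      rw [hQsymm, ← inner_conj_symm, horth, map_zero]
    have h2 : (q x : ℂ) = q (x - y) + q y := by
      rw [← hqQ, ← hqQ, ← hqQ]
      nth_rewrite 1 2 [← sub_add_cancel x y]
      rw [map_add, inner_add_left, inner_add_right, inner_add_right, horth, horth']
      ring
    have h3 : q x = q (x - y) + q y := by exact_mod_cast h2
    linarith [hq_ge (x - y), sq_nonneg ‖x - y‖]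
  refine ⟨S, √(∑ k ∈ range (N + 1), ‖A ^ k‖ ^ 2), hSA, fun n => ?_⟩
  refine ContinuousLinearMap.opNorm_le_bound _ (Real.sqrt_nonneg _) fun x => ?_
  have hqn : q ((S ^ n) x) ≤ q x := by
    induction n with
    | zero => simp
    | succ n ih => rw [pow_succ', mul_apply_eq_comp]; exact (hqS _).trans ih
  rw [← Real.sqrt_sq (norm_nonneg x), ← Real.sqrt_mul (by positivity)]
  exact Real.le_sqrt_of_sq_le ((hq_ge _).trans (hqn.trans (hq_le x)))

/-- The estimate is kept on norms of powers because in this form it passes directly to adjoints. -/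
theorem exists_left_inverse_norm_pow_le {A : K →L[ℂ] K} {r : ℝ} (hr : 0 < r)
    (h : ∀ l : ℂ, ‖l‖ ≤ r → ∃ B : K →L[ℂ] K, B * (l • 1 - A) = 1) :
    ∃ (S : K →L[ℂ] K) (C : ℝ), S * A = 1 ∧ ∀ n : ℕ, ‖S ^ n‖ ≤ C * r⁻¹ ^ n := by
  obtain ⟨c, hc, hlow⟩ := exists_uniform_lower_bound (isCompact_closedBall (0 : ℂ) r)
    fun l hl => h l (by simpa using hl)
  obtain ⟨N, hN⟩ := exists_pow_expanding hr hc fun l hl => hlow l (by simpa using hl)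
  have hrC : (r : ℂ) ≠ 0 := by exact_mod_cast hr.ne'
  obtain ⟨S, C, hS, hC⟩ := exists_power_bounded_left_inverse (A := (r : ℂ)⁻¹ • A) (N := N) (by
    intro x
    rw [smul_pow, smul_apply, norm_smul, norm_pow, norm_inv, Complex.norm_real,
      Real.norm_of_nonneg hr.le, inv_pow, le_inv_mul_iff₀ (by positivity)]
    exact hN x)
  refine ⟨(r : ℂ)⁻¹ • S, C, ?_, fun n => ?_⟩
  · rw [smul_mul_assoc, ← mul_smul_comm, hS]
  · rw [smul_pow, norm_smul, norm_pow, norm_inv, Complex.norm_real, Real.norm_of_nonneg hr.le,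
      mul_comm]
    exact mul_le_mul_of_nonneg_right (hC n) (by positivity)

theorem exists_left_inverse_spectralRadius_le {A : K →L[ℂ] K} {r : ℝ} (hr : 0 < r)
    (h : ∀ l : ℂ, ‖l‖ ≤ r → ∃ B : K →L[ℂ] K, B * (l • 1 - A) = 1) :
    ∃ S : K →L[ℂ] K, S * A = 1 ∧ spectralRadius ℂ S ≤ ENNReal.ofReal r⁻¹ := by
  obtain ⟨S, C, hS, hC⟩ := exists_left_inverse_norm_pow_le hr h
  exact ⟨S, hS, spectralRadius_le_of_norm_pow_le (by positivity) hC⟩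

theorem exists_right_inverse_spectralRadius_le {A : K →L[ℂ] K} {r : ℝ} (hr : 0 < r)
    (h : ∀ l : ℂ, ‖l‖ ≤ r → ∃ B : K →L[ℂ] K, (l • 1 - A) * B = 1) :
    ∃ S : K →L[ℂ] K, A * S = 1 ∧ spectralRadius ℂ S ≤ ENNReal.ofReal r⁻¹ := by
  obtain ⟨S, C, hS, hC⟩ := exists_left_inverse_norm_pow_le (A := star A) hr (by
    intro l hl
    obtain ⟨B, hB⟩ := h (star l) (by simpa using hl)
    refine ⟨star B, ?_⟩
    have := congrArg star hB
    simpa using this)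
  refine ⟨star S, by simpa using congrArg star hS,
    spectralRadius_le_of_norm_pow_le (C := C) (by positivity) fun n => ?_⟩
  rw [← star_pow, norm_star]
  exact hC n

end LeftInverse

/-! ### Gluing along M ⊕ Mᗮ. -/

section Triangular

variable {H : Type*} [NormedAddCommGroup H] [InnerProductSpace ℂ H] [CompleteSpace H]

/-- The spectrum of a block triangular operator is contained in the union of the spectra of its
diagonal blocks. -/
theorem spectrum_subset_of_triangular {M : Submodule ℂ H} [M.HasOrthogonalProjection]
    [CompleteSpace M] {S : H →L[ℂ] H} {S₁ : M →L[ℂ] M} {S₂ : Mᗮ →L[ℂ] Mᗮ}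
    (h₁ : ∀ x : M, S x = S₁ x)
    (h₂ : ∀ x, Mᗮ.orthogonalProjectionOnto (S x) = S₂ (Mᗮ.orthogonalProjectionOnto x)) :
    spectrum ℂ S ⊆ spectrum ℂ S₁ ∪ spectrum ℂ S₂ := by
  intro l hl
  by_contra hcon
  rw [Set.mem_union, not_or, spectrum.notMem_iff, spectrum.notMem_iff,
    Algebra.algebraMap_eq_smul_one, Algebra.algebraMap_eq_smul_one] at hcon
  obtain ⟨u₁, u₂⟩ := hcon
  rw [ContinuousLinearMap.isUnit_iff_bijective] at u₁ u₂
  refine hl (?_ : IsUnit _)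
  rw [Algebra.algebraMap_eq_smul_one, ContinuousLinearMap.isUnit_iff_bijective]
  have h₂' : ∀ x, Mᗮ.orthogonalProjectionOnto ((l • (1 : H →L[ℂ] H) - S) x) =
      (l • (1 : Mᗮ →L[ℂ] Mᗮ) - S₂) (Mᗮ.orthogonalProjectionOnto x) := by
    intro x
    simp only [sub_apply, smul_apply, one_apply_eq_self, map_sub, map_smul, h₂]
  have h₁' : ∀ x : M, (l • (1 : H →L[ℂ] H) - S) x = (l • (1 : M →L[ℂ] M) - S₁) x := by
    intro x
    simp only [sub_apply, smul_apply, one_apply_eq_self, h₁, Submodule.coe_sub, Submodule.coe_smul]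
  have hmem : ∀ x, Mᗮ.orthogonalProjectionOnto x = 0 → x ∈ M := by
    intro x hx
    rw [Submodule.orthogonalProjectionOnto_eq_zero_iff] at hx
    rwa [Submodule.orthogonal_orthogonal] at hx
  constructor
  · rw [injective_iff_map_eq_zero]
    intro x hx
    have hx2 : Mᗮ.orthogonalProjectionOnto x = 0 := by
      refine (injective_iff_map_eq_zero _).1 u₂.1 _ ?_
      rw [← h₂', hx, map_zero]
    have hx1 : (⟨x, hmem x hx2⟩ : M) = 0 := by
      refine (injective_iff_map_eq_zero _).1 u₁.1 _ ?_
      rw [← Submodule.coe_eq_zero, ← h₁', hx]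
    exact congrArg Subtype.val hx1
  · intro y
    obtain ⟨v, hv⟩ := u₂.2 (Mᗮ.orthogonalProjectionOnto y)
    have hm : y - (l • (1 : H →L[ℂ] H) - S) v ∈ M := by
      refine hmem _ ?_
      rw [map_sub, h₂', Submodule.orthogonalProjectionOnto_mem_subspace_eq_self, hv, sub_self]
    obtain ⟨u, hu⟩ := u₁.2 ⟨_, hm⟩
    refine ⟨u + v, ?_⟩
    rw [map_add, h₁', hu, sub_add_cancel]

/-- If `l - T` has inner inverses on a disc and a common hyperrange `M` there, then `T` has an inner
inverse whose spectral radius is at most the inverse of the radius of the disc. -/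
theorem exists_inner_inverse_spectralRadius_le {T : H →L[ℂ] H} {M : Submodule ℂ H} {r : ℝ}
    (hr : 0 < r) (h : ∀ l : ℂ, ‖l‖ ≤ r → ∃ B : H →L[ℂ] H,
      IsRegularInverse (l • (1 : H →L[ℂ] H) - T) B ∧ hyperrange (l • (1 : H →L[ℂ] H) - T) = M) :
    ∃ S : H →L[ℂ] H, T * S * T = T ∧ spectralRadius ℂ S ≤ ENNReal.ofReal r⁻¹ := by
  have hMc : IsClosed (M : Set H) := by
    obtain ⟨B, hB, hM⟩ := h 0 (by simpa using hr.le)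
    exact hM ▸ hB.isClosed_hyperrange
  have : CompleteSpace M := hMc.completeSpace_coe
  have hTM : ∀ x ∈ M, T x ∈ M := by
    obtain ⟨B, hB, hM⟩ := h 0 (by simpa using hr.le)
    intro x hx
    have := map_mem_hyperrange (hM.symm ▸ hx : x ∈ hyperrange ((0 : ℂ) • (1 : H →L[ℂ] H) - T))
    rw [hM] at this
    simpa using this
  set P₁ : H →L[ℂ] M := M.orthogonalProjectionOnto with hP₁
  set P₂ : H →L[ℂ] Mᗮ := Mᗮ.orthogonalProjectionOnto with hP₂
  have hP₁M : ∀ x : M, P₁ x = x := fun x => Submodule.orthogonalProjectionOnto_mem_subspace_eq_self x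
  have hP₂M : ∀ x : Mᗮ, P₂ x = x :=
    fun x => Submodule.orthogonalProjectionOnto_mem_subspace_eq_self x
  have hP₁c : ∀ x ∈ M, (P₁ x : H) = x := fun x hx => congrArg Subtype.val (hP₁M ⟨x, hx⟩)
  have hP₂0 : ∀ x ∈ M, P₂ x = 0 := by
    intro x hx
    rw [hP₂, Submodule.orthogonalProjectionOnto_eq_zero_iff, Submodule.orthogonal_orthogonal]
    exact hx
  have hdec : ∀ x : H, (P₁ x : H) + P₂ x = x := fun x =>
    M.starProjection_add_starProjection_orthogonal x
  have hP₁0 : ∀ x : Mᗮ, P₁ x = 0 := by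
    intro x
    have := hdec x
    rw [hP₂M] at this
    simpa using this
  set T₁ : M →L[ℂ] M := P₁ ∘L T ∘L M.subtypeL with hT₁
  set T₂ : Mᗮ →L[ℂ] Mᗮ := P₂ ∘L T ∘L Mᗮ.subtypeL with hT₂
  have hT₁a : ∀ x : M, (T₁ x : H) = T x := fun x => hP₁c _ (hTM x x.2)
  have hT₂a : ∀ x : H, P₂ (T x) = T₂ (P₂ x) := by
    intro x
    have : P₂ (T x) = P₂ (T (P₁ x)) + P₂ (T (P₂ x)) := by
      rw [← map_add, ← map_add, hdec]
    rw [this, hP₂0 _ (hTM _ (P₁ x).2), zero_add]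
    rfl
  obtain ⟨S₁, hS₁, hS₁r⟩ := exists_right_inverse_spectralRadius_le (A := T₁) hr (by
    intro l hl
    obtain ⟨B, hB, hM⟩ := h l hl
    have hmem : ∀ z, z ∈ hyperrange (l • (1 : H →L[ℂ] H) - T) ↔ z ∈ M := fun z => by rw [hM]
    refine ⟨P₁ ∘L B ∘L M.subtypeL, ?_⟩
    ext x
    have hx : (x : H) ∈ hyperrange (l • (1 : H →L[ℂ] H) - T) := (hmem _).2 x.2
    have hBx : B x ∈ M := (hmem _).1 (hB.map_mem hx)
    have h1 := hB.right_inv hx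
    simp only [sub_apply, smul_apply, one_apply_eq_self] at h1
    simp only [mul_apply_eq_comp, sub_apply, smul_apply, one_apply_eq_self, Submodule.coe_sub,
      Submodule.coe_smul, hT₁a, ContinuousLinearMap.comp_apply, Submodule.subtypeL_apply,
      hP₁c _ hBx, h1])
  -- The compression of B to Mᗮ is a left inverse, since B preserves M and x - B(l - T)x lies in M.
  obtain ⟨S₂, hS₂, hS₂r⟩ := exists_left_inverse_spectralRadius_le (A := T₂) hr (by
    intro l hl
    obtain ⟨B, hB, hM⟩ := h l hl
    have hmem : ∀ z, z ∈ hyperrange (l • (1 : H →L[ℂ] H) - T) ↔ z ∈ M := fun z => by rw [hM]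
    refine ⟨P₂ ∘L B ∘L Mᗮ.subtypeL, ?_⟩
    ext1 x
    set y : H := (l • (1 : H →L[ℂ] H) - T) x with hy
    have h1 : (l • (1 : Mᗮ →L[ℂ] Mᗮ) - T₂) x = P₂ y := by
      rw [hy]
      simp only [sub_apply, smul_apply, one_apply_eq_self, map_sub, map_smul, hT₂a, hP₂M]
    have h2 : P₂ (B (P₁ y)) = 0 := by
      exact hP₂0 _ ((hmem _).1 (hB.map_mem ((hmem _).2 (P₁ y).2)))
    have h3 : P₂ (B (P₂ y)) = P₂ (B y) := by
      conv_rhs => rw [← hdec y]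
      rw [map_add, map_add, h2, zero_add]
    have h4 : P₂ ((x : H) - B y) = 0 := hP₂0 _ ((hmem _).1 (hB.sub_mem (x : H)))
    rw [map_sub, hP₂M, sub_eq_zero] at h4
    rw [mul_apply_eq_comp, h1]
    exact h3.trans h4.symm)
  -- The corner -S₁ P₁ T S₂ cancels the M-component of T S₂ P₂, as T S₁ = 1 on M.
  set S : H →L[ℂ] H := M.subtypeL ∘L S₁ ∘L P₁ + (Mᗮ.subtypeL - M.subtypeL ∘L S₁ ∘L P₁ ∘L T ∘L
    Mᗮ.subtypeL) ∘L S₂ ∘L P₂ with hS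
  have hSa : ∀ x, S x = S₁ (P₁ x) + ((S₂ (P₂ x) : H) - S₁ (P₁ (T (S₂ (P₂ x))))) := fun x => rfl
  have hS₁' : ∀ x : M, S x = S₁ x := by
    intro x
    rw [hSa, hP₁M, hP₂0 _ x.2]
    simp
  have hS₂' : ∀ x, P₂ (S x) = S₂ (P₂ x) := by
    intro x
    rw [hSa, map_add, map_sub, hP₂0 _ (S₁ _).2, hP₂0 _ (S₁ _).2, hP₂M, zero_add, sub_zero]
  have hTS₁ : ∀ x : M, T (S₁ x) = x := by
    intro x
    rw [← hT₁a, ← mul_apply_eq_comp, hS₁, one_apply_eq_self]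
  refine ⟨S, ?_, ?_⟩
  · ext x
    rw [mul_apply_eq_comp, mul_apply_eq_comp, hSa, map_add, map_sub, hTS₁, hTS₁]
    have h1 : S₂ (P₂ (T x)) = P₂ x := by
      rw [hT₂a, ← mul_apply_eq_comp, hS₂, one_apply_eq_self]
    have h2 : T (P₂ x : H) = P₁ (T (P₂ x)) + P₂ (T x) := by
      rw [hT₂a]
      exact (hdec _).symm
    rw [h1, sub_eq_of_eq_add' h2, hdec]
  · refine iSup₂_le fun l hl => ?_
    rcases spectrum_subset_of_triangular hS₁' hS₂' hl with h1 | h1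
    · exact le_trans (le_iSup₂ (f := fun (k : ℂ) (_ : k ∈ spectrum ℂ S₁) => (‖k‖₊ : ℝ≥0∞)) l h1)
        hS₁r
    · exact le_trans (le_iSup₂ (f := fun (k : ℂ) (_ : k ∈ spectrum ℂ S₂) => (‖k‖₊ : ℝ≥0∞)) l h1)
        hS₂r

end Triangular

/-! ### Non-emptiness and the distance formula. -/

theorem exists_inner_inverse_of_closedBall_subset {H : Type*} [NormedAddCommGroup H]
    [InnerProductSpace ℂ H] [CompleteSpace H] [Nontrivial H] {T : H →L[ℂ] H} {r : ℝ} (hr : 0 < r)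
    (h : Metric.closedBall 0 r ⊆ regularDomain T) :
    ∃ S : H →L[ℂ] H, T * S * T = T ∧ spectralRadius ℂ S ≤ ENNReal.ofReal r⁻¹ := by
  refine exists_inner_inverse_spectralRadius_le
    (M := hyperrange ((0 : ℂ) • (1 : H →L[ℂ] H) - T)) hr fun l hl => ?_
  have hl' : l ∈ Metric.closedBall (0 : ℂ) r := by simpa using hl
  obtain ⟨B, hB⟩ := exists_isRegularInverse (h hl')
  exact ⟨B, hB, hyperrange_eq_of_subset_regularDomain (convex_closedBall (0 : ℂ) r).isPreconnected
    h hl' (Metric.mem_closedBall_self hr.le)⟩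

theorem generalizedSpectrum_nonempty {H : Type*} [NormedAddCommGroup H] [InnerProductSpace ℂ H]
    [CompleteSpace H] [Nontrivial H] (T : H →L[ℂ] H) : (generalizedSpectrum T).Nonempty := by
  by_contra hne
  have hreg : ∀ l, l ∈ regularDomain T := fun l => by
    by_contra hl
    exact hne ⟨l, hl⟩
  -- Leaves room for l of modulus ‖T‖ + 1, outside the spectrum of T yet inside the disc where the
  -- inner inverse propagates.
  set r : ℝ := ‖T‖ + 2 with hr
  have hr0 : 0 < r := by positivity
  obtain ⟨S, hS, hSr⟩ := exists_inner_inverse_of_closedBall_subset (T := T) hr0 fun l _ => hreg l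
  have hreg0 := isRegularInverse_of_zero_mem_regularDomain (hreg 0) hS
  set l : ℂ := ((‖T‖ + 1 : ℝ) : ℂ) with hl
  have hln : ‖l‖ = ‖T‖ + 1 := by
    rw [hl, Complex.norm_real, Real.norm_of_nonneg (by positivity)]
  have hlS : (‖l‖₊ : ℝ≥0∞) < (spectralRadius ℂ S)⁻¹ := by
    refine lt_of_lt_of_le ?_ (ENNReal.inv_le_inv.2 hSr)
    rw [ENNReal.ofReal_inv_of_pos hr0, inv_inv, ← enorm_eq_nnnorm, ← ofReal_norm,
      ENNReal.ofReal_lt_ofReal_iff hr0, hln]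
    linarith
  have hinner := hreg0.sub_smul_inner hlS
  have hu1 : IsUnit (T - l • 1) := by
    have : l ∉ spectrum ℂ T := fun hmem => by
      have := spectrum.norm_le_norm_of_mem hmem
      linarith
    rw [spectrum.notMem_iff, Algebra.algebraMap_eq_smul_one] at this
    simpa using this.neg
  have hu2 := spectrum.isUnit_one_sub_smul_of_lt_inv_radius hlS
  -- An inner inverse of a unit is its inverse; multiplying by 1 - lS then gives TS = 1.
  have h1 : (T - l • 1) * (S * Ring.inverse (1 - l • S)) = 1 :=
    hu1.mul_right_cancel (by rw [hinner, one_mul])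
  have h2 : (T - l • 1) * S = 1 - l • S := by
    have := congrArg (fun C => C * (1 - l • S)) h1
    simpa only [mul_assoc, Ring.inverse_mul_cancel _ hu2, mul_one, one_mul] using this
  have hTS : T * S = 1 := by
    rwa [sub_mul, smul_mul_assoc, one_mul, sub_left_inj] at h2
  have hTu : IsUnit T := by
    have hSu : IsUnit S := (hu1.mul_left_iff).1 (h2 ▸ hu2)
    obtain ⟨v, rfl⟩ := hSu
    rw [← Units.inv_eq_of_mul_eq_one_left hTS]
    exact v⁻¹.isUnit
  obtain ⟨u, rfl⟩ := hTu
  obtain rfl : S = ↑u⁻¹ := (Units.inv_eq_of_mul_eq_one_right hTS).symm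
  obtain ⟨k, hk⟩ := spectrum.nonempty (u : H →L[ℂ] H)
  have hk0 : k ≠ 0 := spectrum.ne_zero_of_mem_of_unit hk
  have hk' : k⁻¹ ∈ spectrum ℂ (↑u⁻¹ : H →L[ℂ] H) := by
    have := (spectrum.inv_mem_iff (r := Units.mk0 k hk0) (a := u)).1 (by simpa using hk)
    simpa using this
  have h1 : (‖k⁻¹‖₊ : ℝ≥0∞) ≤ ENNReal.ofReal r⁻¹ := le_trans
    (le_iSup₂ (f := fun (k : ℂ) (_ : k ∈ spectrum ℂ (↑u⁻¹ : H →L[ℂ] H)) => (‖k‖₊ : ℝ≥0∞)) _ hk') hSr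
  rw [← enorm_eq_nnnorm, ← ofReal_norm, ENNReal.ofReal_le_ofReal_iff (by positivity), norm_inv,
    inv_le_inv₀ (by simpa using hk0) hr0] at h1
  have := spectrum.norm_le_norm_of_mem hk
  linarith

theorem theorem2p3 {H : Type*} [NormedAddCommGroup H] [InnerProductSpace ℂ H] [CompleteSpace H]
    [Nontrivial H] (T : H →L[ℂ] H) (hT : (0 : ℂ) ∈ regularDomain T) :
    (generalizedSpectrum T).Nonempty ∧
      Metric.infEDist (0 : ℂ) (generalizedSpectrum T) =
        ⨆ (S : H →L[ℂ] H) (_ : T * S * T = T), 1 / spectralRadius ℂ S := by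
  refine ⟨generalizedSpectrum_nonempty T, le_antisymm ?_ ?_⟩
  · refine le_of_forall_lt fun c hc => ?_
    -- A radius strictly below the distance is needed for the closed disc to lie in reg(T).
    obtain ⟨r, hcr, hr⟩ := ENNReal.lt_iff_exists_nnreal_btwn.1 hc
    have hr0 : 0 < (r : ℝ) := by exact_mod_cast pos_of_gt hcr
    obtain ⟨S, hS, hSr⟩ := exists_inner_inverse_of_closedBall_subset (T := T) hr0 fun l hl => by
      by_contra hmem
      have h1 := Metric.infEDist_le_edist_of_mem (x := (0 : ℂ))
        (show l ∈ generalizedSpectrum T from hmem)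
      have h2 : edist (0 : ℂ) l ≤ r := by
        rw [edist_comm, edist_nndist]
        exact_mod_cast hl
      exact absurd (h1.trans h2) (not_le.2 hr)
    refine hcr.trans_le (le_trans ?_ (le_iSup₂ (f := fun (S : H →L[ℂ] H) (_ : T * S * T = T) =>
      1 / spectralRadius ℂ S) S hS))
    rw [one_div]
    refine le_trans ?_ (ENNReal.inv_le_inv.2 hSr)
    rw [ENNReal.ofReal_inv_of_pos hr0, inv_inv, ENNReal.ofReal_coe_nnreal]
  · refine iSup₂_le fun S hS => Metric.le_infEDist.2 fun l hl => ?_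
    by_contra! hlt
    rw [edist_zero_left, one_div] at hlt
    exact hl (mem_regularDomain_of_lt (isRegularInverse_of_zero_mem_regularDomain hT hS) hlt)
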